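/- Let $k\ge 2$ be an even integer. There is a constant $c_k>0$ depending only on $k$ such that the following holds. Let $d=d(n)\ge 1$ be integers with $d\log n = o(n)$ as $n\to\infty$, and let $p=p(n)\in[0,1]$ satisfy $p\cdot d^{k/2-1}n^{k/2}>1$ (both for all sufficiently large $n$). Let $\Phi$ be a random instance of $k$-XOR on $n$ variables with clause probability $p$: independently for each $S\in[n]^k$, with probability $p$ the constraint $\prod_{i\in S}x_i=\eta_S$ with a uniformly random sign $\eta_S\in\{\pm1\}$ is present, and with probability $1-p$ there is no constraint on $S$. Let $\mathbf T_\Phi$ be the order-$k$ tensor with $(\mathbf T_\Phi)_S=\eta_S$ if the constraint on $S$ is present and $(\mathbf T_\Phi)_S=0$ otherwise, and let $T$ be its natural $n^{k/2}\times n^{k/2}$ flattening (the row index is the first half of $S$, the column index the second half). Let $T^{\otimes d}$ be the $d$-fold Kronecker power, with rows and columns indexed by $[n]^{dk/2}$, and form $$\mathop{\mathbb E}_{\Pi,\Sigma}\left[\Pi\, T^{\otimes d}\,\Sigma\right],$$ where $\Pi,\Sigma$ are independent and uniform over the $(dk/2)!$ permutations of the $dk/2$ index positions, acting as $n^{dk/2}\times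 n^{dk/2}$ permutation matrices. Let $C_{(d)}$ be obtained from this matrix by replacing by zero every row and every column whose index contains some $i\in[n]$ more than $10\log n$ times. Then, with probability tending to $1$ as $n\to\infty$, the spectral norm of $C_{(d)}$ satisfies $$\|C_{(d)}\|^{1/d}\ \le\ c_k\,\log^{2k} n\cdot\frac{p^{1/2}\,n^{k/4}}{d^{(k-2)/4}}.$$ -/

import Mathlib

open MeasureTheory Filter Topology Asymptotics

/-- A `k`-XOR instance on `n` variables. For every `S ∈ [n]^k`, the value `none` means that there
is no constraint on `S`, and `some η` means that the constraint `∏ i ∈ S, x i = η` is present. -/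
abbrev XorInstance (k n : ℕ) : Type := (Fin k → Fin n) → Option ℤˣ

instance : MeasurableSpace (Option ℤˣ) := ⊤

/-- The law of one potential clause: absent with probability `1 - p`, and otherwise present with a
uniformly random sign. -/
noncomputable def clauseLaw (p : ℝ) : Measure (Option ℤˣ) :=
  ENNReal.ofReal (1 - p) • Measure.dirac none
    + ENNReal.ofReal (p / 2) • Measure.dirac (some 1)
    + ENNReal.ofReal (p / 2) • Measure.dirac (some (-1))

/-- The law of a random `k`-XOR instance with clause probability `p`: all `S ∈ [n]^k` are
treated independently. -/
noncomputable def randomXor (k n : ℕ) (p : ℝ) : Measure (XorInstance k n) :=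
  Measure.pi fun _ => clauseLaw p

/-- The order-`k` tensor of an instance. -/
def xorTensor {k n : ℕ} (Φ : XorInstance k n) (S : Fin k → Fin n) : ℝ :=
  match Φ S with
  | none => 0
  | some η => ((η : ℤ) : ℝ)

theorem even_eq_half_add_half {k : ℕ} (hk : Even k) : k = k / 2 + k / 2 := by
  obtain ⟨r, rfl⟩ := hk
  omega

/-- The natural `n^(k/2) × n^(k/2)` matrix flattening of an order-`k` tensor: the row index is the
first half of the tensor index, the column index is the second half. -/
def flattening {k n : ℕ} (hk : Even k) (T : (Fin k → Fin n) → ℝ) :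
    Matrix (Fin (k / 2) → Fin n) (Fin (k / 2) → Fin n) ℝ :=
  Matrix.of fun I J => T (Fin.append I J ∘ Fin.cast (even_eq_half_add_half hk))

/-- The `d`-th Kronecker power of a matrix with rows and columns indexed by `[n]^r`. An element of
`[n]^(dr)` is written as a function on `Fin d × Fin r`, whose `l`-th block is `fun a => I (l, a)`. -/
def kroneckerPower {n r : ℕ} (d : ℕ) (M : Matrix (Fin r → Fin n) (Fin r → Fin n) ℝ) :
    Matrix (Fin d × Fin r → Fin n) (Fin d × Fin r → Fin n) ℝ :=
  Matrix.of fun I J => ∏ l : Fin d, M (fun a => I (l, a)) (fun a => J (l, a))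

/-- The permutation matrix on `[n]^P` which permutes the `P` coordinates of an index. -/
def indexPermMatrix {P : Type} [Fintype P] [DecidableEq P] (n : ℕ) (π : Equiv.Perm P) :
    Matrix (P → Fin n) (P → Fin n) ℝ :=
  Equiv.Perm.permMatrix ℝ (Equiv.arrowCongr π (Equiv.refl (Fin n)))

/-- The average of `Π M Σ` over independent uniform index permutations `Π`, `Σ`. -/
noncomputable def symmetrize {P : Type} [Fintype P] [DecidableEq P] {n : ℕ}
    (M : Matrix (P → Fin n) (P → Fin n) ℝ) : Matrix (P → Fin n) (P → Fin n) ℝ :=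
  ((Fintype.card (Equiv.Perm P) : ℝ) ^ 2)⁻¹ •
    ∑ π : Equiv.Perm P, ∑ σ : Equiv.Perm P, indexPermMatrix n π * M * indexPermMatrix n σ

/-- Some element of `[n]` occurs more than `10 log n` times among the coordinates of `I`. -/
def HighMultiplicity {P : Type} [Fintype P] {n : ℕ} (I : P → Fin n) : Prop :=
  ∃ i : Fin n, 10 * Real.log n < ((Finset.univ.filter fun a => I a = i).card : ℝ)

open Classical in
/-- Replace by zero all rows and columns whose index has an element of high multiplicity. -/
noncomputable def zeroOutHigh {P : Type} [Fintype P] {n : ℕ}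
    (M : Matrix (P → Fin n) (P → Fin n) ℝ) : Matrix (P → Fin n) (P → Fin n) ℝ :=
  Matrix.of fun I J => if HighMultiplicity I ∨ HighMultiplicity J then 0 else M I J

/-- The level-`d` certificate matrix of a `k`-XOR instance, for even `k`. -/
noncomputable def xorCertificate {k n : ℕ} (hk : Even k) (d : ℕ) (Φ : XorInstance k n) :
    Matrix (Fin d × Fin (k / 2) → Fin n) (Fin d × Fin (k / 2) → Fin n) ℝ :=
  zeroOutHigh (symmetrize (kroneckerPower d (flattening hk (xorTensor Φ))))

/-- The spectral norm of a real square matrix: its operator norm on Euclidean space. -/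
noncomputable def matrixOpNorm {ι : Type} [Fintype ι] [DecidableEq ι] (M : Matrix ι ι ℝ) : ℝ :=
  ‖Matrix.toEuclideanCLM (n := ι) (𝕜 := ℝ) M‖

/-! The proof is a trace moment argument. Write `r = k / 2` and let `C` be the certificate. Then
`‖C‖ ^ (2ℓ) ≤ tr ((C Cᵀ) ^ ℓ)` with `ℓ` of order `log n`, and the expected trace is a sum over
closed walks of `2ℓ` steps, each step using `d` hyperedges.

Put `q = 1 / (n ^ r * d ^ (r - 1))` and `z = √(p / q)`; the density hypothesis says `z > 1`. Odd
moments of a clause vanish and even ones equal `p = z ^ 2 * q`, so a monomial has expectation at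
most `z ^ degree * q ^ (number of distinct hyperedges)`. It remains to sum this weight over walks.

In one step from a row `I`, average over the index permutation and sum over the next index `J`. A
slot with a new hyperedge costs `q` and leaves its block of `J` free. A slot repeating one of the
`O(ℓ d)` known hyperedges determines its block of `J`, and low multiplicity leaves at most `(10 log
n) ^ r` positions for its `r` left vertices. The choice of `q` makes both kinds of slot contribute
`d ^ (-(r - 1))` up to logarithmic factors (`repeating_weight_le`, `sum_weight_le`). Iterating by
`MomentBound.edgeCertificate_mulVec` bounds the expected trace, and Markov's inequality concludes.
-/

/-! ### Spectral norm and traces. -/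

theorem matrixOpNorm_sq_le_sum_sq {ι : Type} [Fintype ι] [DecidableEq ι] (M : Matrix ι ι ℝ) :
    matrixOpNorm M ^ 2 ≤ ∑ i, ∑ j, M i j ^ 2 := by
  have h0 : 0 ≤ ∑ i, ∑ j, M i j ^ 2 := by positivity
  have h : matrixOpNorm M ≤ Real.sqrt (∑ i, ∑ j, M i j ^ 2) := by
    refine ContinuousLinearMap.opNorm_le_bound _ (Real.sqrt_nonneg _) fun x => ?_
    rw [EuclideanSpace.norm_eq, EuclideanSpace.norm_eq, ← Real.sqrt_mul h0]
    refine Real.sqrt_le_sqrt ?_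
    rw [Finset.sum_mul]
    refine Finset.sum_le_sum fun i _ => ?_
    simp only [Real.norm_eq_abs, sq_abs]
    rw [Matrix.ofLp_toEuclideanCLM]
    exact Finset.sum_mul_sq_le_sq_mul_sq _ _ _
  calc matrixOpNorm M ^ 2 ≤ Real.sqrt (∑ i, ∑ j, M i j ^ 2) ^ 2 :=
        pow_le_pow_left₀ (norm_nonneg _) h 2
    _ = _ := Real.sq_sqrt h0

-- For the self-adjoint matrix `M * Mᵀ`, the norm of a `2 ^ j`-th power is the power of the norm.
-- The trace of the next squaring is the squared Frobenius norm of that power, which dominates its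
-- squared operator norm.
open scoped Matrix.Norms.L2Operator in
theorem matrixOpNorm_pow_le_trace {ι : Type} [Fintype ι] [DecidableEq ι] (M : Matrix ι ι ℝ)
    (j : ℕ) :
    matrixOpNorm M ^ (2 * 2 ^ (j + 1)) ≤ ((M * M.transpose) ^ 2 ^ (j + 1)).trace := by
  set A := (M * M.transpose) ^ 2 ^ j with hA
  have hsa : IsSelfAdjoint (M * M.transpose) := by
    rw [← Matrix.conjTranspose_eq_transpose_of_trivial]
    exact Matrix.isHermitian_mul_conjTranspose_self M
  have hA' : A.transpose = A := by
    rw [hA, Matrix.transpose_pow, Matrix.transpose_mul, Matrix.transpose_transpose]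
  have h1 : matrixOpNorm A = matrixOpNorm M ^ (2 * 2 ^ j) := by
    have h2 := hsa.norm_pow_two_pow j
    have h3 : ‖M * M.transpose‖ = ‖M‖ * ‖M‖ := by
      rw [← Matrix.conjTranspose_eq_transpose_of_trivial]
      exact CStarRing.norm_self_mul_star
    rw [h3, ← sq, ← pow_mul] at h2
    exact h2
  have h2 := matrixOpNorm_sq_le_sum_sq A
  rw [h1] at h2
  have h3 : (M * M.transpose) ^ 2 ^ (j + 1) = A * A.transpose := by
    rw [hA', hA, ← pow_add]; congr 1; ring
  rw [h3]
  calc _ = (matrixOpNorm M ^ (2 * 2 ^ j)) ^ 2 := by rw [← pow_mul]; congr 1; ring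
    _ ≤ _ := h2
    _ = _ := by
      simp [Matrix.trace, Matrix.mul_apply, sq]

/-! ### Counting steps that repeat hyperedges. -/

/-- The `l`-th block of an index. -/
def indexBlock {d r : ℕ} {α : Type} (I : Fin d × Fin r → α) (l : Fin d) : Fin r → α :=
  fun a => I (l, a)

/-- The hyperedge in slot `l` of a pair of indices. -/
def slotEdge {d r n : ℕ} {E : Type} (e : (Fin r → Fin n) → (Fin r → Fin n) → E)
    (I J : Fin d × Fin r → Fin n) (l : Fin d) : E :=
  e (indexBlock I l) (indexBlock J l)

/-- A hyperedge of `H` determines both the vertices `I ∘ f` and the block `y`. Each of the `r`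
vertices sits at no more than `μ` positions of `I`, so at most `μ ^ r` choices of `f` remain. -/
theorem card_incidences_le {P E : Type} [Fintype P] [DecidableEq P] [DecidableEq E] {r n μ : ℕ}
    {e : (Fin r → Fin n) → (Fin r → Fin n) → E} (he : Function.Injective2 e) {I : P → Fin n}
    (hI : ∀ i, (Finset.univ.filter fun a => I a = i).card ≤ μ) (H : Finset E) :
    (Finset.univ.filter fun fy : (Fin r → P) × (Fin r → Fin n) =>
      e (I ∘ fy.1) fy.2 ∈ H).card ≤ H.card * μ ^ r := by
  rw [mul_comm]
  refine Finset.card_le_mul_card_image_of_maps_to 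
    (f := fun fy : (Fin r → P) × (Fin r → Fin n) => e (I ∘ fy.1) fy.2)
    (fun x hx => (Finset.mem_filter.1 hx).2) _ fun b _ => ?_
  rcases Finset.eq_empty_or_nonempty ((Finset.univ.filter
    fun fy : (Fin r → P) × (Fin r → Fin n) => e (I ∘ fy.1) fy.2 ∈ H).filter
      fun fy => e (I ∘ fy.1) fy.2 = b) with h0 | ⟨⟨f0, y0⟩, h0⟩
  · rw [h0]; simp
  simp only [Finset.mem_filter, Finset.mem_univ, true_and] at h0
  calc _ ≤ (Fintype.piFinset fun a : Fin r =>
        Finset.univ.filter fun q => I q = I (f0 a)).card := by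
        refine Finset.card_le_card_of_injOn Prod.fst ?_ ?_
        · rintro ⟨f, y⟩ h
          simp only [Finset.coe_filter, Finset.mem_filter, Finset.mem_univ, true_and,
            Set.mem_ofPred_eq] at h
          have := (he (h.2.trans h0.2.symm)).1
          simp only [Finset.mem_coe, Fintype.mem_piFinset, Finset.mem_filter, Finset.mem_univ,
            true_and]
          exact fun a => congrFun this a
        · rintro ⟨f, y⟩ h ⟨f', y'⟩ h' hf
          simp only [Finset.coe_filter, Finset.mem_filter, Finset.mem_univ, true_and,
            Set.mem_ofPred_eq] at h h'
          have := (he (h.2.trans h'.2.symm)).2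
          exact Prod.ext hf this
    _ ≤ μ ^ r := by
        rw [Fintype.card_piFinset]
        calc _ ≤ ∏ _a : Fin r, μ := Finset.prod_le_prod' fun a _ => hI _
          _ = _ := by simp

/-- `R` is the set of slots allowed to carry new hyperedges. Fix the permutation and the index on
the blocks in `R`: this gives the second factor. The known hyperedges then form a fixed set of size
at most `H.card + d`, and every other slot is bounded by `card_incidences_le`. -/
theorem card_repeating_le {E : Type} [DecidableEq E] {d r n μ : ℕ}
    {e : (Fin r → Fin n) → (Fin r → Fin n) → E} (he : Function.Injective2 e)
    {I : Fin d × Fin r → Fin n} (hI : ∀ i, (Finset.univ.filter fun a => I a = i).card ≤ μ)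
    (H : Finset E) (R : Finset (Fin d)) :
    (Finset.univ.filter fun x : Equiv.Perm (Fin d × Fin r) × (Fin d × Fin r → Fin n) =>
        ∀ l ∉ R, slotEdge e (I ∘ x.1) x.2 l ∈ H ∪ R.image (slotEdge e (I ∘ x.1) x.2)).card ≤
      ((H.card + d) * μ ^ r) ^ (d - R.card) *
        ((d * r).descFactorial (R.card * r) * n ^ (R.card * r)) := by
  set s := Finset.univ.filter fun x : Equiv.Perm (Fin d × Fin r) × (Fin d × Fin r → Fin n) =>
        ∀ l ∉ R, slotEdge e (I ∘ x.1) x.2 l ∈ H ∪ R.image (slotEdge e (I ∘ x.1) x.2) with hs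
  let Q := {q : Fin d × Fin r // q.1 ∈ R}
  let F : Equiv.Perm (Fin d × Fin r) × (Fin d × Fin r → Fin n) →
      (Q ↪ Fin d × Fin r) × (Q → Fin n) := fun x =>
    (⟨fun q => x.1 q.1, fun a b h => Subtype.ext (x.1.injective h)⟩, fun q => x.2 q.1)
  have hQ : Fintype.card Q = R.card * r := by
    rw [Fintype.card_subtype]
    have : (Finset.univ.filter fun q : Fin d × Fin r => q.1 ∈ R) = R ×ˢ Finset.univ := by
      ext q; simp
    rw [this, Finset.card_product]; simp
  have hcard : Fintype.card ((Q ↪ Fin d × Fin r) × (Q → Fin n)) =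
      (d * r).descFactorial (R.card * r) * n ^ (R.card * r) := by
    rw [Fintype.card_prod, Fintype.card_embedding_eq, Fintype.card_fun, hQ]
    simp
  rw [← hcard, ← Finset.card_univ]
  refine Finset.card_le_mul_card_image_of_maps_to (f := F) (fun x _ => Finset.mem_univ _) _
    fun b _ => ?_
  rcases Finset.eq_empty_or_nonempty (s.filter fun x => F x = b) with h0 | ⟨x0, h0⟩
  · rw [h0]; simp
  have key : ∀ x ∈ s.filter (fun x => F x = b), ∀ l ∈ R, ∀ a,
      x.1 (l, a) = x0.1 (l, a) ∧ x.2 (l, a) = x0.2 (l, a) := by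
    intro x hx l hl a
    have h : F x = F x0 := (Finset.mem_filter.1 hx).2.trans (Finset.mem_filter.1 h0).2.symm
    have h1 := DFunLike.congr_fun (congrArg Prod.fst h) ⟨(l, a), hl⟩
    have h2 := congrFun (congrArg Prod.snd h) ⟨(l, a), hl⟩
    exact ⟨h1, h2⟩
  set H' := H ∪ R.image (slotEdge e (I ∘ x0.1) x0.2) with hH'
  have hH'c : H'.card ≤ H.card + d := by
    refine (Finset.card_union_le _ _).trans (Nat.add_le_add_left ?_ _)
    exact Finset.card_image_le.trans ((Finset.card_le_univ R).trans (by simp))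
  calc (s.filter fun x => F x = b).card
      ≤ (Fintype.piFinset fun _ : {l // l ∉ R} =>
          Finset.univ.filter fun fy : (Fin r → Fin d × Fin r) × (Fin r → Fin n) =>
            e (I ∘ fy.1) fy.2 ∈ H').card := by
        refine Finset.card_le_card_of_injOn
          (fun x l => (indexBlock x.1 l.1, indexBlock x.2 l.1)) ?_ ?_
        · intro x hx
          simp only [Finset.mem_coe, Fintype.mem_piFinset, Finset.mem_filter, Finset.mem_univ,
            true_and]
          intro l
          have h1 := (Finset.mem_filter.1 (Finset.mem_filter.1 hx).1).2 l.1 l.2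
          -- The hyperedges in the slots of `R` are constant on a fibre of `F`, so all elements of
          -- the fibre share the target set `H'`.
          have h2 : R.image (slotEdge e (I ∘ x.1) x.2) = R.image (slotEdge e (I ∘ x0.1) x0.2) := by
            refine Finset.image_congr fun l hl => ?_
            have h := key x hx l hl
            exact congrArg₂ e (funext fun a => congrArg I (h a).1) (funext fun a => (h a).2)
          rw [h2] at h1
          exact h1
        · intro x hx y hy hxy
          have h3 : ∀ q : Fin d × Fin r, x.1 q = y.1 q ∧ x.2 q = y.2 q := by
            rintro ⟨l, a⟩
            by_cases hl : l ∈ R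
            · exact ⟨(key x hx l hl a).1.trans (key y hy l hl a).1.symm,
                (key x hx l hl a).2.trans (key y hy l hl a).2.symm⟩
            · have h4 := congrFun hxy ⟨l, hl⟩
              exact ⟨congrFun (congrArg Prod.fst h4) a, congrFun (congrArg Prod.snd h4) a⟩
          exact Prod.ext (Equiv.ext fun q => (h3 q).1) (funext fun q => (h3 q).2)
    _ ≤ ((H.card + d) * μ ^ r) ^ (d - R.card) := by
        rw [Fintype.card_piFinset, Finset.prod_const, Finset.card_univ, Fintype.card_subtype_compl,
          Fintype.card_fin, Fintype.card_coe]
        exact Nat.pow_le_pow_left ((card_incidences_le he hI H').trans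
          (Nat.mul_le_mul_right _ hH'c)) _

/-- A subset on which `f` is injective with the same image outside `H` as `f` has. -/
theorem exists_card_eq_card_image_sdiff {ι E : Type} [Fintype ι] [DecidableEq ι] [DecidableEq E]
    (f : ι → E) (H : Finset E) :
    ∃ R : Finset ι, R.card = (Finset.univ.image f \ H).card ∧ ∀ l, f l ∈ H ∪ R.image f := by
  have h : ∀ x : {x // x ∈ Finset.univ.image f \ H}, ∃ l, f l = x := fun x => by
    simpa using (Finset.mem_sdiff.1 x.2).1
  choose g hg using h
  have hinj : Function.Injective g := fun x y hxy => Subtype.ext (by rw [← hg x, ← hg y, hxy])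
  refine ⟨Finset.univ.image g, ?_, fun l => ?_⟩
  · rw [Finset.card_image_of_injective _ hinj]; simp
  · by_cases hl : f l ∈ H
    · exact Finset.mem_union_left _ hl
    · refine Finset.mem_union_right _ (Finset.mem_image.2 ?_)
      have hm : f l ∈ Finset.univ.image f \ H :=
        Finset.mem_sdiff.2 ⟨Finset.mem_image_of_mem _ (Finset.mem_univ _), hl⟩
      exact ⟨g ⟨f l, hm⟩, Finset.mem_image_of_mem _ (Finset.mem_univ _), hg _⟩

/-! ### Factorial estimates and the weight of one step. -/

theorem natCast_pow_self_le_exp_mul_factorial (d : ℕ) :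
    (d : ℝ) ^ d ≤ Real.exp 1 ^ d * (d.factorial : ℝ) := by
  have h := Real.pow_div_factorial_le_exp (x := (d : ℝ)) (Nat.cast_nonneg d) d
  rw [div_le_iff₀ (by positivity)] at h
  rwa [Real.exp_one_pow]

theorem factorial_pow_le_factorial_mul (m r : ℕ) : m.factorial ^ r ≤ (m * r).factorial := by
  have h := Nat.prod_factorial_dvd_factorial_sum (Finset.range r) fun _ => m
  simp only [Finset.prod_const, Finset.sum_const, Finset.card_range, smul_eq_mul] at h
  rw [mul_comm m r]
  exact Nat.le_of_dvd (Nat.factorial_pos _) h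

/-- Up to `e ^ (d * r)`, the falling factorial is `(d * r)! / d ^ ((d - s) * r)`. This follows from
`((d - s)!) ^ r ≤ ((d - s) * r)!`, `d! ≤ d ^ s * (d - s)!` and `d ^ d ≤ e ^ d * d!`. -/
theorem descFactorial_mul_pow_le {d s : ℕ} (r : ℕ) (hs : s ≤ d) :
    ((d * r).descFactorial (s * r) : ℝ) * (d : ℝ) ^ (d * r) ≤
      ((d * r).factorial : ℝ) * (d : ℝ) ^ (s * r) * Real.exp 1 ^ (d * r) := by
  have h1 : ((d * r - s * r).factorial : ℝ) * ((d * r).descFactorial (s * r) : ℝ) =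
      ((d * r).factorial : ℝ) := by
    exact_mod_cast Nat.factorial_mul_descFactorial (Nat.mul_le_mul_right r hs)
  have h2 : ((d - s).factorial : ℝ) ^ r ≤ ((d * r - s * r).factorial : ℝ) := by
    rw [← Nat.sub_mul]
    exact_mod_cast factorial_pow_le_factorial_mul (d - s) r
  have h3 : (d.factorial : ℝ) ≤ (d : ℝ) ^ s * ((d - s).factorial : ℝ) := by
    have h4 := Nat.factorial_mul_descFactorial hs
    have h5 := Nat.descFactorial_le_pow d s
    rw [← h4, Nat.cast_mul, mul_comm]
    gcongr
    exact_mod_cast h5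
  have h4 := natCast_pow_self_le_exp_mul_factorial d
  rw [← h1, pow_mul, pow_mul _ s, pow_mul _ d]
  calc ((d * r).descFactorial (s * r) : ℝ) * ((d : ℝ) ^ d) ^ r
      ≤ ((d * r).descFactorial (s * r) : ℝ) *
          (Real.exp 1 ^ d * ((d : ℝ) ^ s * ((d - s).factorial : ℝ))) ^ r := by
        gcongr
        exact h4.trans (by gcongr)
    _ = ((d - s).factorial : ℝ) ^ r * ((d * r).descFactorial (s * r) : ℝ) * ((d : ℝ) ^ s) ^ r *
          (Real.exp 1 ^ d) ^ r := by ring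
    _ ≤ _ := by gcongr

/-- The choice of `q` makes the bound independent of the number `s` of new hyperedges: `q ^ s`
cancels `n ^ (s * r)`, and the exponents of `d` add up as `-(r - 1) * s + (d - s) - (d - s) * r =
-(r - 1) * d`. -/
theorem repeating_weight_le {d r n μ s h : ℕ} {a q : ℝ} (hr : 1 ≤ r) (hd : 1 ≤ d) (hn : 1 ≤ n)
    (hμ : 1 ≤ μ) (ha : 1 ≤ a) (hq : q = ((n : ℝ) ^ r * (d : ℝ) ^ (r - 1))⁻¹) (hs : s ≤ d)
    (hh : (h : ℝ) + d ≤ a * d) :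
    q ^ s * ((((h + d) * μ ^ r) ^ (d - s) *
        ((d * r).descFactorial (s * r) * n ^ (s * r)) : ℕ) : ℝ) ≤
      ((d * r).factorial : ℝ) * (a * (Real.exp 1 * μ) ^ r / (d : ℝ) ^ (r - 1)) ^ d := by
  have hd0 : (0 : ℝ) < d := by exact_mod_cast hd
  have hn0 : (0 : ℝ) < n := by exact_mod_cast hn
  have hμ1 : (1 : ℝ) ≤ (μ : ℝ) ^ r := one_le_pow₀ (by exact_mod_cast hμ)
  have h1 := descFactorial_mul_pow_le r hs
  have h2 : (((h : ℝ) + d) * (μ : ℝ) ^ r) ^ (d - s) ≤ (a * (μ : ℝ) ^ r) ^ d * (d : ℝ) ^ (d - s) := by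
    calc _ ≤ (a * d * (μ : ℝ) ^ r) ^ (d - s) := by gcongr
      _ = (a * (μ : ℝ) ^ r) ^ (d - s) * (d : ℝ) ^ (d - s) := by rw [← mul_pow]; congr 1; ring
      _ ≤ _ := by
        gcongr
        · nlinarith
        · omega
  obtain ⟨r, rfl⟩ : ∃ r', r = r' + 1 := ⟨r - 1, by omega⟩
  simp only [Nat.add_sub_cancel] at *
  push_cast
  have h3 : q ^ s * (n : ℝ) ^ (s * (r + 1)) = ((d : ℝ) ^ (r * s))⁻¹ := by
    rw [hq, inv_pow, mul_pow, ← pow_mul, ← pow_mul, mul_comm s (r + 1)]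
    field_simp
  have h5 : ((d * (r + 1)).descFactorial (s * (r + 1)) : ℝ) * (d : ℝ) ^ (d - s) *
      ((d : ℝ) ^ (r * s))⁻¹ ≤
      ((d * (r + 1)).factorial : ℝ) * Real.exp 1 ^ (d * (r + 1)) / (d : ℝ) ^ (r * d) := by
    rw [← div_eq_mul_inv, div_le_div_iff₀ (by positivity) (by positivity)]
    refine le_of_mul_le_mul_right ?_ (pow_pos hd0 s)
    calc _ = ((d * (r + 1)).descFactorial (s * (r + 1)) : ℝ) *
          ((d : ℝ) ^ (d - s) * (d : ℝ) ^ s * (d : ℝ) ^ (r * d)) := by ring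
      _ = ((d * (r + 1)).descFactorial (s * (r + 1)) : ℝ) * (d : ℝ) ^ (d * (r + 1)) := by
        rw [← pow_add, ← pow_add, Nat.sub_add_cancel hs]; congr 2; ring
      _ ≤ _ := h1
      _ = _ := by rw [mul_add, pow_add]; ring
  calc _ = (((h : ℝ) + d) * (μ : ℝ) ^ (r + 1)) ^ (d - s) *
        ((d * (r + 1)).descFactorial (s * (r + 1)) : ℝ) *
          (q ^ s * (n : ℝ) ^ (s * (r + 1))) := by ring
    _ ≤ ((a * (μ : ℝ) ^ (r + 1)) ^ d * (d : ℝ) ^ (d - s)) *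
        ((d * (r + 1)).descFactorial (s * (r + 1)) : ℝ) * ((d : ℝ) ^ (r * s))⁻¹ := by
        rw [h3]; gcongr
    _ = (a * (μ : ℝ) ^ (r + 1)) ^ d * (((d * (r + 1)).descFactorial (s * (r + 1)) : ℝ) *
        (d : ℝ) ^ (d - s) * ((d : ℝ) ^ (r * s))⁻¹) := by ring
    _ ≤ (a * (μ : ℝ) ^ (r + 1)) ^ d * (((d * (r + 1)).factorial : ℝ) *
        Real.exp 1 ^ (d * (r + 1)) / (d : ℝ) ^ (r * d)) := by gcongr
    _ = _ := by
        rw [div_pow, mul_pow, mul_pow a, mul_pow (Real.exp 1), mul_pow (Real.exp 1 ^ (r + 1)),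
          ← pow_mul, ← pow_mul, ← pow_mul, mul_comm (r + 1) d]
        ring

/-- One step of a walk multiplies the weight by a bounded factor on average. -/
theorem sum_weight_le {E : Type} [DecidableEq E] {d r n μ : ℕ} {a q : ℝ}
    {e : (Fin r → Fin n) → (Fin r → Fin n) → E} (he : Function.Injective2 e)
    {I : Fin d × Fin r → Fin n} (hI : ∀ i, (Finset.univ.filter fun a => I a = i).card ≤ μ)
    (hr : 1 ≤ r) (hd : 1 ≤ d) (hn : 1 ≤ n) (hμ : 1 ≤ μ) (ha : 1 ≤ a)
    (hq : q = ((n : ℝ) ^ r * (d : ℝ) ^ (r - 1))⁻¹) (H : Finset E)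
    (hH : (H.card : ℝ) + d ≤ a * d) :
    ∑ π : Equiv.Perm (Fin d × Fin r), ∑ J : Fin d × Fin r → Fin n,
        q ^ (H ∪ Finset.univ.image (slotEdge e (I ∘ π) J)).card ≤
      q ^ H.card * (((d * r).factorial : ℝ) *
        (2 * a * (Real.exp 1 * μ) ^ r / (d : ℝ) ^ (r - 1)) ^ d) := by
  classical
  have hq0 : 0 ≤ q := by rw [hq]; positivity
  set W := a * (Real.exp 1 * μ) ^ r / (d : ℝ) ^ (r - 1) with hW
  let good (R : Finset (Fin d)) (x : Equiv.Perm (Fin d × Fin r) × (Fin d × Fin r → Fin n)) : Prop :=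
    ∀ l ∉ R, slotEdge e (I ∘ x.1) x.2 l ∈ H ∪ R.image (slotEdge e (I ∘ x.1) x.2)
  have hpt : ∀ x : Equiv.Perm (Fin d × Fin r) × (Fin d × Fin r → Fin n),
      q ^ (H ∪ Finset.univ.image (slotEdge e (I ∘ x.1) x.2)).card ≤
        q ^ H.card * ∑ R : Finset (Fin d), q ^ R.card * (if good R x then 1 else 0) := by
    intro x
    -- `R` holds one slot for each new hyperedge, so `q ^ R.card` is exactly the weight gained.
    -- Summing over all `R` instead of this one costs the factor `2 ^ d`.
    obtain ⟨R, hR, hR'⟩ := exists_card_eq_card_image_sdiff (slotEdge e (I ∘ x.1) x.2) H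
    have hg : good R x := fun l _ => hR' l
    rw [← Finset.union_sdiff_self_eq_union, Finset.card_union_of_disjoint Finset.disjoint_sdiff,
      pow_add, ← hR]
    gcongr
    calc q ^ R.card = q ^ R.card * (if good R x then 1 else 0) := by rw [if_pos hg, mul_one]
      _ ≤ _ := Finset.single_le_sum
        (f := fun R : Finset (Fin d) => q ^ R.card * (if good R x then (1 : ℝ) else 0))
        (fun R _ => by split_ifs <;> positivity) (Finset.mem_univ R)
  rw [← Fintype.sum_prod_type']
  calc _ ≤ ∑ x : Equiv.Perm (Fin d × Fin r) × (Fin d × Fin r → Fin n),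
        q ^ H.card * ∑ R : Finset (Fin d), q ^ R.card * (if good R x then 1 else 0) :=
        Finset.sum_le_sum fun x _ => hpt x
    _ = q ^ H.card * ∑ R : Finset (Fin d),
        q ^ R.card * ((Finset.univ.filter (good R)).card : ℝ) := by
        rw [← Finset.mul_sum, Finset.sum_comm]
        congr 1
        refine Finset.sum_congr rfl fun R _ => ?_
        rw [← Finset.mul_sum, Finset.sum_boole]
    _ ≤ q ^ H.card * ∑ _R : Finset (Fin d), ((d * r).factorial : ℝ) * W ^ d := by
        refine mul_le_mul_of_nonneg_left (Finset.sum_le_sum fun R _ => ?_) (by positivity)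
        refine le_trans ?_ (repeating_weight_le (s := R.card) hr hd hn hμ ha hq
          ((Finset.card_le_univ R).trans (by simp)) hH)
        refine mul_le_mul_of_nonneg_left ?_ (by positivity)
        exact_mod_cast card_repeating_le he hI H R
    _ = _ := by
        rw [Finset.sum_const, Finset.card_univ, Fintype.card_finset, Fintype.card_fin, hW]
        rw [nsmul_eq_mul, mul_assoc 2 a, mul_div_assoc 2, mul_pow 2]
        push_cast
        ring

/-! ### Moments of the random clauses. -/

/-- The tensor entry of a clause. -/
def clauseValue : Option ℤˣ → ℝ
  | none => 0
  | some η => ((η : ℤ) : ℝ)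

theorem xorTensor_eq_clauseValue {k n : ℕ} (Φ : XorInstance k n) (S : Fin k → Fin n) :
    xorTensor Φ S = clauseValue (Φ S) := by
  unfold xorTensor clauseValue
  cases Φ S <;> rfl

theorem isProbabilityMeasure_clauseLaw {p : ℝ} (hp : p ∈ Set.Icc (0 : ℝ) 1) :
    IsProbabilityMeasure (clauseLaw p) := by
  refine ⟨?_⟩
  simp only [clauseLaw, Measure.add_apply, Measure.smul_apply, measure_univ, smul_eq_mul, mul_one]
  rw [← ENNReal.ofReal_add (by linarith [hp.2]) (by linarith [hp.1]),
    ← ENNReal.ofReal_add (by linarith [hp.1, hp.2]) (by linarith [hp.1])]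
  rw [← ENNReal.ofReal_one]
  congr 1; ring

theorem integral_clauseLaw {p : ℝ} (hp : p ∈ Set.Icc (0 : ℝ) 1) (f : Option ℤˣ → ℝ) :
    ∫ x, f x ∂clauseLaw p = (1 - p) * f none + p / 2 * f (some 1) + p / 2 * f (some (-1)) := by
  have hi : ∀ (c : ℝ) (x : Option ℤˣ), Integrable f (ENNReal.ofReal c • Measure.dirac x) :=
    fun c x => (Integrable.of_finite (μ := Measure.dirac x)).smul_measure ENNReal.ofReal_ne_top
  unfold clauseLaw
  rw [integral_add_measure ((hi _ _).add_measure (hi _ _)) (hi _ _),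
    integral_add_measure (hi _ _) (hi _ _)]
  simp only [integral_smul_measure, integral_dirac, smul_eq_mul]
  rw [ENNReal.toReal_ofReal (by linarith [hp.2]), ENNReal.toReal_ofReal (by linarith [hp.1])]

/-- Odd moments vanish by the symmetry of the sign. An even moment equals `p = z ^ 2 * q`, and `z ≥
1` lets the exponent grow from `2` to `m`. Thus each factor is charged `z` and each distinct clause
`q`. -/
theorem integral_clauseValue_pow {p q z : ℝ} (hp : p ∈ Set.Icc (0 : ℝ) 1) (hq : 0 ≤ q)
    (hz : 1 ≤ z) (hpq : p = z ^ 2 * q) {m : ℕ} (hm : m ≠ 0) :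
    ∫ x, clauseValue x ^ m ∂clauseLaw p ∈ Set.Icc 0 (z ^ m * q) := by
  rw [integral_clauseLaw hp]
  simp only [clauseValue, Units.val_one, Units.val_neg, Int.cast_one, Int.cast_neg, one_pow,
    zero_pow hm]
  rcases Nat.even_or_odd m with h | h
  · rw [h.neg_one_pow]
    have h2 : 2 ≤ m := by obtain ⟨t, rfl⟩ := h; omega
    refine ⟨by linarith [hp.1], ?_⟩
    calc _ = z ^ 2 * q := by rw [← hpq]; ring
      _ ≤ _ := by gcongr
  · rw [h.neg_one_pow]
    have : 0 ≤ z ^ m * q := by positivity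
    exact ⟨by linarith, by linarith⟩

theorem integral_prod_xorTensor_le {k n : ℕ} {p q z : ℝ} (hp : p ∈ Set.Icc (0 : ℝ) 1)
    (hq : 0 ≤ q) (hz : 1 ≤ z) (hpq : p = z ^ 2 * q) (L : Multiset (Fin k → Fin n)) :
    ∫ Φ, (L.map (xorTensor Φ)).prod ∂randomXor k n p ≤ z ^ L.card * q ^ L.toFinset.card := by
  have := isProbabilityMeasure_clauseLaw hp
  have h1 : ∀ Φ : XorInstance k n,
      (L.map (xorTensor Φ)).prod = ∏ S, clauseValue (Φ S) ^ L.count S := by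
    intro Φ
    rw [Finset.prod_multiset_map_count]
    simp only [xorTensor_eq_clauseValue]
    refine Finset.prod_subset (Finset.subset_univ _) fun S _ hS => ?_
    rw [Multiset.count_eq_zero.2 (by simpa using hS), pow_zero]
  simp only [h1]
  unfold randomXor
  rw [integral_fintype_prod_eq_prod (fun S x => clauseValue x ^ L.count S)]
  have h2 : ∏ S, ∫ x, clauseValue x ^ L.count S ∂clauseLaw p =
      ∏ S ∈ L.toFinset, ∫ x, clauseValue x ^ L.count S ∂clauseLaw p := by
    refine (Finset.prod_subset (Finset.subset_univ _) fun S _ hS => ?_).symm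
    rw [Multiset.count_eq_zero.2 (by simpa using hS)]
    simp
  rw [h2]
  have h3 : ∀ S ∈ L.toFinset,
      ∫ x, clauseValue x ^ L.count S ∂clauseLaw p ∈ Set.Icc 0 (z ^ L.count S * q) := fun S hS =>
    integral_clauseValue_pow hp hq hz hpq (Multiset.count_ne_zero.2 (by simpa using hS))
  calc _ ≤ ∏ S ∈ L.toFinset, (z ^ L.count S * q) :=
        Finset.prod_le_prod (fun S hS => (h3 S hS).1) fun S hS => (h3 S hS).2
    _ = _ := by
      rw [Finset.prod_mul_distrib, Finset.prod_pow_eq_pow_sum, Multiset.toFinset_sum_count_eq,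
        Finset.prod_const]

/-! ### The certificate in terms of hyperedges. -/

open Classical in
/-- The truncated symmetrization of the Kronecker power of the matrix `(x, y) ↦ T (e x y)`. -/
noncomputable def edgeCertificate {E : Type} {d r n : ℕ}
    (e : (Fin r → Fin n) → (Fin r → Fin n) → E) (T : E → ℝ) :
    Matrix (Fin d × Fin r → Fin n) (Fin d × Fin r → Fin n) ℝ :=
  Matrix.of fun I J => if HighMultiplicity I ∨ HighMultiplicity J then 0 else
    ((Fintype.card (Equiv.Perm (Fin d × Fin r)) : ℝ) ^ 2)⁻¹ *
      ∑ π : Equiv.Perm (Fin d × Fin r), ∑ σ : Equiv.Perm (Fin d × Fin r),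
        ∏ l, T (slotEdge e (I ∘ π) (J ∘ σ) l)

theorem indexPermMatrix_mul_mul_apply {P : Type} [Fintype P] [DecidableEq P] {n : ℕ}
    (π σ : Equiv.Perm P) (M : Matrix (P → Fin n) (P → Fin n) ℝ) (I J : P → Fin n) :
    (indexPermMatrix n π * M * indexPermMatrix n σ) I J = M (I ∘ π.symm) (J ∘ σ) := by
  unfold indexPermMatrix Equiv.Perm.permMatrix
  rw [PEquiv.mul_toMatrix_toPEquiv, PEquiv.toMatrix_toPEquiv_mul]
  rfl

/-- The hyperedge with given first and second half. -/
def joinHalves {k n : ℕ} (hk : Even k) (x y : Fin (k / 2) → Fin n) : Fin k → Fin n :=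
  Fin.append x y ∘ Fin.cast (even_eq_half_add_half hk)

theorem joinHalves_injective2 {k n : ℕ} (hk : Even k) :
    Function.Injective2 (joinHalves (n := n) hk) := by
  intro x x' y y' h
  have h1 : Fin.append x y = Fin.append x' y' := by
    funext i
    have := congrFun h (Fin.cast (even_eq_half_add_half hk).symm i)
    simpa [joinHalves] using this
  exact ⟨funext fun a => by simpa using congrFun h1 (Fin.castAdd _ a),
    funext fun a => by
      have := congrFun h1 (Fin.natAdd _ a)
      rwa [Fin.append_right, Fin.append_right] at this⟩

theorem xorCertificate_eq {k n d : ℕ} (hk : Even k) (Φ : XorInstance k n) :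
    xorCertificate hk d Φ = edgeCertificate (joinHalves hk) (xorTensor Φ) := by
  ext I J
  simp only [xorCertificate, zeroOutHigh, edgeCertificate, Matrix.of_apply, symmetrize,
    Matrix.smul_apply, Matrix.sum_apply, indexPermMatrix_mul_mul_apply, smul_eq_mul]
  congr 2
  exact Fintype.sum_equiv (Equiv.inv _) _ _ fun π => rfl

/-- Transposing only swaps the two halves of a hyperedge, so a step estimate for general `e` serves
both `C` and `Cᵀ`. -/
theorem transpose_edgeCertificate {E : Type} {d r n : ℕ}
    (e : (Fin r → Fin n) → (Fin r → Fin n) → E) (T : E → ℝ) :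
    (edgeCertificate (d := d) e T).transpose = edgeCertificate (fun x y => e y x) T := by
  ext I J
  simp only [edgeCertificate, Matrix.transpose_apply, Matrix.of_apply]
  rw [Finset.sum_comm]
  by_cases h : HighMultiplicity I ∨ HighMultiplicity J
  · rw [if_pos h, if_pos h.symm]
  · rw [if_neg h, if_neg fun h' => h h'.symm]
    rfl

/-! ### Propagating moment bounds along a walk. -/

/-- Every monomial `∏ S ∈ L, T S` has a mixed moment with every coordinate of `v` that is bounded
in terms of its degree and of the number of distinct variables in it. -/
def MomentBound {Ω E X : Type} [DecidableEq E] [MeasurableSpace Ω] (P : Measure Ω) (T : Ω → E → ℝ)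
    (z q K : ℝ) (v : Ω → X → ℝ) (m : ℕ) (β : ℝ) : Prop :=
  ∀ (L : Multiset E) (I : X), (L.card : ℝ) + m ≤ K →
    ∫ ω, (L.map (T ω)).prod * v ω I ∂P ≤ β * (z ^ (L.card + m) * q ^ L.toFinset.card)

/-- The multiset `L` records the hyperedges already used by the walk. Expanding one matrix product
adds the `d` hyperedges of the step to `L`; the bound for `v` applies to the enlarged monomial, and
`sum_weight_le` sums the resulting weights. -/
theorem MomentBound.edgeCertificate_mulVec {Ω E : Type} [DecidableEq E] [MeasurableSpace Ω]
    [Finite Ω] [MeasurableSingletonClass Ω] {P : Measure Ω} [IsFiniteMeasure P] {T : Ω → E → ℝ}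
    {d r n μ : ℕ} {z q a β : ℝ} {e : (Fin r → Fin n) → (Fin r → Fin n) → E}
    (he : Function.Injective2 e) (hr : 1 ≤ r) (hd : 1 ≤ d) (hn : 1 ≤ n) (hμ : 1 ≤ μ) (ha : 1 ≤ a)
    (hz : 0 ≤ z) (hβ : 0 ≤ β) (hq : q = ((n : ℝ) ^ r * (d : ℝ) ^ (r - 1))⁻¹)
    (hlow : ∀ I : Fin d × Fin r → Fin n, ¬ HighMultiplicity I →
      ∀ i, (Finset.univ.filter fun a => I a = i).card ≤ μ)
    {v : Ω → (Fin d × Fin r → Fin n) → ℝ} {m : ℕ}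
    (hv : MomentBound P T z q (a * d) v m β) :
    MomentBound P T z q (a * d) (fun ω => (edgeCertificate e (T ω)).mulVec (v ω)) (m + d)
      (β * (2 * a * (Real.exp 1 * μ) ^ r / (d : ℝ) ^ (r - 1)) ^ d) := by
  classical
  intro L I hL
  have hq0 : 0 ≤ q := by rw [hq]; positivity
  set B := (2 * a * (Real.exp 1 * μ) ^ r / (d : ℝ) ^ (r - 1)) ^ d with hB
  have hB0 : 0 ≤ B := by positivity
  by_cases hI : HighMultiplicity I
  · have : ∀ ω, (edgeCertificate e (T ω)).mulVec (v ω) I = 0 := fun ω => by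
      simp [Matrix.mulVec, dotProduct, edgeCertificate, hI]
    simp only [this, mul_zero, integral_zero]
    positivity
  set N : ℝ := (Fintype.card (Equiv.Perm (Fin d × Fin r)) : ℝ) with hN
  have hNf : N = ((d * r).factorial : ℝ) := by
    rw [hN, Fintype.card_perm, Fintype.card_prod, Fintype.card_fin, Fintype.card_fin]
  have hN0 : 0 < N := by rw [hNf]; positivity
  set c := β * z ^ (L.card + (m + d)) with hc
  have hc0 : 0 ≤ c := by positivity
  let S (π σ : Equiv.Perm (Fin d × Fin r)) (J : Fin d × Fin r → Fin n) : Multiset E :=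
    Finset.univ.val.map (slotEdge e (I ∘ π) (J ∘ σ))
  have hS : ∀ π σ J, (S π σ J).card = d := fun π σ J => by simp [S]
  have hS' : ∀ π σ J, (L + S π σ J).toFinset =
      L.toFinset ∪ Finset.univ.image (slotEdge e (I ∘ π) (J ∘ σ)) := fun π σ J => by
    rw [Multiset.toFinset_add]; rfl
  have hterm : ∀ π σ J, ∫ ω, ((L + S π σ J).map (T ω)).prod * v ω J ∂P ≤
      c * q ^ (L.toFinset ∪ Finset.univ.image (slotEdge e (I ∘ π) (J ∘ σ))).card := by
    intro π σ J
    have h := hv (L + S π σ J) J (by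
      rw [Multiset.card_add, hS]; push_cast at hL ⊢; linarith)
    rw [hS', Multiset.card_add, hS] at h
    rw [hc, mul_assoc]
    convert h using 4
    ring
  have hexp : ∀ ω, (L.map (T ω)).prod * (edgeCertificate e (T ω)).mulVec (v ω) I =
      ∑ J, if HighMultiplicity J then 0 else (N ^ 2)⁻¹ *
        ∑ π, ∑ σ, ((L + S π σ J).map (T ω)).prod * v ω J := by
    intro ω
    simp only [Matrix.mulVec, dotProduct, edgeCertificate, Matrix.of_apply, hI, false_or]
    rw [Finset.mul_sum]
    refine Finset.sum_congr rfl fun J _ => ?_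
    split_ifs with hJ
    · simp
    · simp only [S, Multiset.map_add, Multiset.prod_add, Multiset.map_map, Finset.mul_sum,
        Finset.sum_mul]
      refine Finset.sum_congr rfl fun π _ => Finset.sum_congr rfl fun σ _ => ?_
      rw [Finset.prod_eq_multiset_prod]
      simp only [Function.comp_def]
      ring
  have hint : ∀ f : Ω → ℝ, Integrable f P := fun f => Integrable.of_finite
  simp only [hexp]
  rw [integral_finsetSum _ fun _ _ => hint _]
  calc _ ≤ ∑ J : Fin d × Fin r → Fin n, (N ^ 2)⁻¹ * ∑ π : Equiv.Perm (Fin d × Fin r),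
        ∑ σ : Equiv.Perm (Fin d × Fin r),
          c * q ^ (L.toFinset ∪ Finset.univ.image (slotEdge e (I ∘ π) (J ∘ σ))).card := by
        refine Finset.sum_le_sum fun J _ => ?_
        split_ifs with hJ
        -- Columns of high multiplicity are kept in the upper bound, whose terms are nonnegative;
        -- only the truncation of rows matters.
        · rw [integral_zero]; positivity
        · rw [integral_const_mul, integral_finsetSum _ fun _ _ => hint _]
          gcongr with π _
          rw [integral_finsetSum _ fun _ _ => hint _]
          exact Finset.sum_le_sum fun σ _ => hterm π σ J
    _ = (N ^ 2)⁻¹ * c * ∑ σ : Equiv.Perm (Fin d × Fin r), ∑ π : Equiv.Perm (Fin d × Fin r),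
        ∑ J : Fin d × Fin r → Fin n,
          q ^ (L.toFinset ∪ Finset.univ.image (slotEdge e (I ∘ π) (J ∘ σ))).card := by
        simp only [← Finset.mul_sum]
        rw [← mul_assoc]
        congr 1
        exact Finset.sum_comm.trans
          ((Finset.sum_congr rfl fun π _ => Finset.sum_comm).trans Finset.sum_comm)
    _ = (N ^ 2)⁻¹ * c * ∑ σ : Equiv.Perm (Fin d × Fin r), ∑ π : Equiv.Perm (Fin d × Fin r),
        ∑ J : Fin d × Fin r → Fin n,
          q ^ (L.toFinset ∪ Finset.univ.image (slotEdge e (I ∘ π) J)).card := by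
        congr 1
        refine Finset.sum_congr rfl fun σ _ => Finset.sum_congr rfl fun π _ => ?_
        -- As `J` runs over all indices, `σ` is absorbed by relabelling. The gain comes from
        -- averaging over `π` alone.
        exact Fintype.sum_equiv (Equiv.arrowCongr σ.symm (Equiv.refl _)) _ _ fun J => rfl
    _ ≤ (N ^ 2)⁻¹ * c * ∑ _σ : Equiv.Perm (Fin d × Fin r), q ^ L.toFinset.card * (N * B) := by
        refine mul_le_mul_of_nonneg_left (Finset.sum_le_sum fun σ _ => ?_) (by positivity)
        rw [hNf]
        refine sum_weight_le he (hlow I hI) hr hd hn hμ ha hq L.toFinset ?_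
        -- The degree budget `L.card + m + d ≤ a * d` supplies the size condition on the set of
        -- known hyperedges.
        have h1 : (L.toFinset.card : ℝ) ≤ L.card := by exact_mod_cast Multiset.toFinset_card_le L
        push_cast at hL
        have h2 : (0 : ℝ) ≤ m := Nat.cast_nonneg m
        linarith
    _ = _ := by
        rw [Finset.sum_const, Finset.card_univ, nsmul_eq_mul, ← hN, hc]
        have h1 : (N ^ 2)⁻¹ * (N * N) = 1 := by rw [sq]; exact inv_mul_cancel₀ (by positivity)
        generalize (N ^ 2)⁻¹ = t at h1
        clear_value B N
        linear_combination (β * z ^ (L.card + (m + d)) * q ^ L.toFinset.card * B) * h1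

/-! ### The expected trace. -/

theorem isProbabilityMeasure_randomXor (k n : ℕ) {p : ℝ} (hp : p ∈ Set.Icc (0 : ℝ) 1) :
    IsProbabilityMeasure (randomXor k n p) := by
  have := isProbabilityMeasure_clauseLaw hp
  unfold randomXor
  infer_instance

theorem card_filter_le_of_not_highMultiplicity {P : Type} [Fintype P] {n : ℕ} {I : P → Fin n}
    (hI : ¬ HighMultiplicity I) (i : Fin n) :
    (Finset.univ.filter fun a => I a = i).card ≤ ⌊10 * Real.log n⌋₊ := by
  refine Nat.le_floor ?_
  by_contra h
  exact hI ⟨i, by simpa using h⟩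

/-- Induction on `t`, each stage applying the step estimate to `Cᵀ` and then to `C`. The budget `2 *
ℓ * d` is the total degree of a walk of `2 * ℓ` steps, whence `a = 2 * ℓ`. -/
theorem momentBound_xorCertificate_pow {k n d ℓ t : ℕ} {p q z : ℝ} (hk : Even k) (hk2 : 2 ≤ k)
    (hd : 1 ≤ d) (hn : 1 ≤ n) (hlog : 1 ≤ Real.log n) (hℓ : 1 ≤ ℓ) (hp : p ∈ Set.Icc (0 : ℝ) 1)
    (hq : q = ((n : ℝ) ^ (k / 2) * (d : ℝ) ^ (k / 2 - 1))⁻¹) (hz : 1 ≤ z) (hpq : p = z ^ 2 * q)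
    (I : Fin d × Fin (k / 2) → Fin n) :
    MomentBound (randomXor k n p) xorTensor z q ((2 * ℓ : ℝ) * d)
      (fun Φ => ((xorCertificate hk d Φ * (xorCertificate hk d Φ).transpose) ^ t).mulVec
        (Pi.single I 1)) (t * (2 * d))
      (((2 * (2 * ℓ : ℝ) * (Real.exp 1 * (⌊10 * Real.log n⌋₊ : ℕ)) ^ (k / 2) /
        (d : ℝ) ^ (k / 2 - 1)) ^ d) ^ (2 * t)) := by
  have := isProbabilityMeasure_randomXor k n hp
  have hq0 : 0 ≤ q := by rw [hq]; positivity
  have hμ : 1 ≤ ⌊10 * Real.log n⌋₊ := Nat.le_floor (by push_cast; linarith)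
  have ha : (1 : ℝ) ≤ 2 * ℓ := by
    have : (1 : ℝ) ≤ ℓ := by exact_mod_cast hℓ
    linarith
  have hr : 1 ≤ k / 2 := by omega
  induction t with
  | zero =>
    intro L J _
    simp only [pow_zero, Matrix.one_mulVec, mul_zero, zero_mul, add_zero, one_mul]
    rcases eq_or_ne J I with rfl | h
    · simpa using integral_prod_xorTensor_le hp hq0 hz hpq L
    · simp only [Pi.single_eq_of_ne h, mul_zero, integral_zero]
      positivity
  | succ t ih =>
    have h1 := (ih.edgeCertificate_mulVec (e := fun x y => joinHalves hk y x)
      (fun x x' y y' h => (joinHalves_injective2 hk h).symm) hr hd hn hμ ha (by linarith)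
      (by positivity) hq fun I hI => card_filter_le_of_not_highMultiplicity hI)
    have h2 := (h1.edgeCertificate_mulVec (joinHalves_injective2 hk) hr hd hn hμ ha (by linarith)
      (by positivity) hq fun I hI => card_filter_le_of_not_highMultiplicity hI)
    convert h2 using 1
    · funext Φ
      rw [← transpose_edgeCertificate (joinHalves hk), ← xorCertificate_eq, Matrix.mulVec_mulVec,
        Matrix.mulVec_mulVec, pow_succ', Matrix.mul_assoc]
    · ring
    · rw [mul_add, pow_add]; ring

theorem integral_trace_xorCertificate_le {k n d ℓ : ℕ} {p q z : ℝ} (hk : Even k) (hk2 : 2 ≤ k)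
    (hd : 1 ≤ d) (hn : 1 ≤ n) (hlog : 1 ≤ Real.log n) (hℓ : 1 ≤ ℓ) (hp : p ∈ Set.Icc (0 : ℝ) 1)
    (hq : q = ((n : ℝ) ^ (k / 2) * (d : ℝ) ^ (k / 2 - 1))⁻¹) (hz : 1 ≤ z)
    (hpq : p = z ^ 2 * q) :
    ∫ Φ, ((xorCertificate hk d Φ * (xorCertificate hk d Φ).transpose) ^ ℓ).trace
        ∂randomXor k n p ≤
      (n : ℝ) ^ (d * (k / 2)) * (z * (4 * ℓ * (Real.exp 1 * (10 * Real.log n)) ^ (k / 2) /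
        (d : ℝ) ^ (k / 2 - 1))) ^ (2 * ℓ * d) := by
  have := isProbabilityMeasure_randomXor k n hp
  have h1 : ∀ I : Fin d × Fin (k / 2) → Fin n, ∫ Φ,
      ((xorCertificate hk d Φ * (xorCertificate hk d Φ).transpose) ^ ℓ) I I ∂randomXor k n p ≤
      (z * (4 * ℓ * (Real.exp 1 * (10 * Real.log n)) ^ (k / 2) /
        (d : ℝ) ^ (k / 2 - 1))) ^ (2 * ℓ * d) := by
    intro I
    -- With the empty monomial and the basis vector at `I`, the mixed moment is the expected
    -- diagonal entry, and the degree budget is met with equality.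
    have h := momentBound_xorCertificate_pow (t := ℓ) hk hk2 hd hn hlog hℓ hp hq hz hpq I 0 I
      (by push_cast; simp; linarith)
    simp only [Multiset.map_zero, Multiset.prod_zero, one_mul, Multiset.card_zero, zero_add,
      Multiset.toFinset_zero, Finset.card_empty, pow_zero, mul_one, Matrix.mulVec_single,
      MulOpposite.op_one, one_smul] at h
    refine h.trans ?_
    rw [mul_pow z, mul_comm (z ^ _), ← pow_mul, show d * (2 * ℓ) = 2 * ℓ * d by ring,
      show ℓ * (2 * d) = 2 * ℓ * d by ring]
    rw [← mul_assoc 2 2 (ℓ : ℝ), show (2 * 2 : ℝ) = 4 by norm_num]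
    gcongr
    exact Nat.floor_le (by linarith)
  simp only [Matrix.trace, Matrix.diag_apply]
  rw [integral_finsetSum _ fun _ _ => Integrable.of_finite]
  refine (Finset.sum_le_sum fun I _ => h1 I).trans (le_of_eq ?_)
  rw [Finset.sum_const, Finset.card_univ, nsmul_eq_mul]
  congr 1
  simp

/-! ### Markov's inequality and the conclusion. -/

theorem measure_xorCertificate_norm_gt_le {k n d : ℕ} {p : ℝ} (hk : Even k) (hk2 : 2 ≤ k)
    (hd : 1 ≤ d) (hn : 1 ≤ n) (hlog : 1 ≤ Real.log n) (hp : p ∈ Set.Icc (0 : ℝ) 1)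
    (hpd : 1 < p * (d : ℝ) ^ (k / 2 - 1) * (n : ℝ) ^ (k / 2)) :
    (randomXor k n p).real {Φ | ¬ matrixOpNorm (xorCertificate hk d Φ) ^ (1 / (d : ℝ)) ≤
        8 * (10 * Real.exp 2) ^ (k / 2) * Real.log n ^ (2 * k) *
          (p ^ (1 / 2 : ℝ) * (n : ℝ) ^ ((k : ℝ) / 4) / (d : ℝ) ^ (((k : ℝ) - 2) / 4))} ≤
      (n : ℝ)⁻¹ := by
  have := isProbabilityMeasure_randomXor k n hp
  have hd0 : (0 : ℝ) < d := by exact_mod_cast hd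
  have hn0 : (0 : ℝ) < n := by exact_mod_cast hn
  have hn1 : (1 : ℝ) ≤ n := by exact_mod_cast hn
  have hp0 : 0 < p := by
    rcases hp.1.eq_or_lt with h | h
    · rw [← h] at hpd; simp at hpd; linarith
    · exact h
  -- The power of two `ℓ = 2 ^ (j + 1)` lies between `log n` and `2 * log n`.
  obtain ⟨j, hj, hj'⟩ := exists_nat_pow_near hlog one_lt_two
  set r := k / 2 with hr
  have hr1 : 1 ≤ r := by omega
  have hkr : k = 2 * r := by obtain ⟨s, rfl⟩ := hk; omega
  set ℓ : ℕ := 2 ^ (j + 1) with hℓ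
  have hℓ1 : 1 ≤ ℓ := Nat.one_le_two_pow
  have hℓlog : Real.log n ≤ ℓ := by rw [hℓ]; push_cast; exact hj'.le
  have hℓlog' : (ℓ : ℝ) ≤ 2 * Real.log n := by rw [hℓ]; push_cast; rw [pow_succ]; linarith
  set W := p ^ (1 / 2 : ℝ) * (n : ℝ) ^ ((k : ℝ) / 4) / (d : ℝ) ^ (((k : ℝ) - 2) / 4) with hW
  have hW0 : 0 < W := by positivity
  set τ := 8 * (10 * Real.exp 2) ^ r * Real.log n ^ (2 * k) * W with hτ
  have hτ0 : 0 < τ := by positivity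
  set y := p * (d : ℝ) ^ (r - 1) * (n : ℝ) ^ r with hy
  set z := Real.sqrt y with hz
  have hz1 : 1 ≤ z := Real.one_le_sqrt.2 hpd.le
  have hzsq : z ^ 2 = y := Real.sq_sqrt (by linarith)
  have hzW : z / (d : ℝ) ^ (r - 1) = W := by
    have h1 : (z / (d : ℝ) ^ (r - 1)) ^ 2 = W ^ 2 := by
      rw [div_pow, hzsq, hy, hW, div_pow, mul_pow, ← Real.rpow_natCast, ← Real.rpow_natCast,
        ← Real.rpow_natCast, ← Real.rpow_natCast, ← Real.rpow_natCast, ← Real.rpow_natCast,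
        ← Real.rpow_mul hp0.le, ← Real.rpow_mul hn0.le, ← Real.rpow_mul hd0.le,
        ← Real.rpow_mul hd0.le, hkr, Nat.cast_sub hr1]
      push_cast
      rw [show (1 / 2 * 2 : ℝ) = 1 by norm_num, Real.rpow_one,
        show (2 * (r : ℝ) / 4 * 2) = r by ring,
        show ((2 * (r : ℝ) - 2) / 4 * 2) = r - 1 by ring,
        show ((r : ℝ) - 1) * 2 = (r - 1) + (r - 1) by ring, Real.rpow_add hd0]
      field_simp
    exact (pow_left_inj₀ (by positivity) hW0.le two_ne_zero).1 h1
  -- The constant in `τ` has `exp 2` where the trace bound has `exp 1`; the spare factor `exp r` is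
  -- what Markov's inequality uses up.
  have hbase : z * (4 * ℓ * (Real.exp 1 * (10 * Real.log n)) ^ r / (d : ℝ) ^ (r - 1)) ≤
      Real.exp (-r) * τ := by
    calc _ = 4 * ℓ * (Real.exp 1 * 10) ^ r * Real.log n ^ r * (z / (d : ℝ) ^ (r - 1)) := by
          rw [← mul_assoc (Real.exp 1), mul_pow _ (Real.log n)]; ring
      _ ≤ 4 * (2 * Real.log n) * (Real.exp 1 * 10) ^ r * Real.log n ^ r * W := by
          rw [hzW]; gcongr
      _ = 8 * (Real.exp 1 * 10) ^ r * Real.log n ^ (r + 1) * W := by ring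
      _ ≤ 8 * (Real.exp 1 * 10) ^ r * Real.log n ^ (2 * k) * W := by
          gcongr
          omega
      _ = Real.exp (-r) * τ := by
          have h2 : Real.exp 2 = Real.exp 1 * Real.exp 1 := by rw [← Real.exp_add]; norm_num
          have h3 : Real.exp (-r) * Real.exp 1 ^ r = 1 := by
            rw [Real.exp_one_pow, ← Real.exp_add]; simp
          rw [hτ, h2, mul_pow, mul_pow, mul_pow]
          linear_combination (-8 * Real.exp 1 ^ r * 10 ^ r * Real.log n ^ (2 * k) * W) * h3
  -- Since `ℓ ≥ log n`, the gain is at least `n ^ (2 * d * r)`, which beats the dimension `n ^ (d *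
  -- r)` of the trace.
  have hexp : (n : ℝ) ^ (d * r) * Real.exp (-r) ^ (2 * ℓ * d) ≤ (n : ℝ)⁻¹ := by
    have h1 : Real.exp (-r) ^ (2 * ℓ * d) ≤ ((n : ℝ) ^ (2 * (d * r)))⁻¹ := by
      rw [← Real.exp_nat_mul, ← Real.exp_log (inv_pos.2 (pow_pos hn0 _)), Real.log_inv,
        Real.log_pow]
      refine Real.exp_le_exp.2 ?_
      push_cast
      have h2 : 2 * ((d : ℝ) * r) * Real.log n ≤ 2 * ((d : ℝ) * r) * ℓ := by gcongr
      linarith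
    have h2 : (n : ℝ) ≤ (n : ℝ) ^ (d * r) :=
      le_self_pow₀ hn1 (Nat.mul_ne_zero (by omega) (by omega))
    calc _ ≤ (n : ℝ) ^ (d * r) * ((n : ℝ) ^ (2 * (d * r)))⁻¹ := by gcongr
      _ = ((n : ℝ) ^ (d * r))⁻¹ := by rw [two_mul, pow_add]; field_simp
      _ ≤ _ := inv_anti₀ hn0 h2
  have htr := integral_trace_xorCertificate_le (d := d) (n := n) (ℓ := ℓ) (p := p) hk hk2 hd hn
    hlog hℓ1 hp rfl hz1 (by rw [hzsq, hy, ← hr]; field_simp)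
  have hsub : {Φ : XorInstance k n |
      ¬ matrixOpNorm (xorCertificate hk d Φ) ^ (1 / (d : ℝ)) ≤ τ} ⊆
      {Φ | τ ^ (2 * ℓ * d) ≤
        ((xorCertificate hk d Φ * (xorCertificate hk d Φ).transpose) ^ ℓ).trace} := by
    intro Φ hΦ
    refine le_trans ?_ (matrixOpNorm_pow_le_trace (xorCertificate hk d Φ) j)
    have hm : 0 ≤ matrixOpNorm (xorCertificate hk d Φ) := norm_nonneg _
    have h1 : τ ^ d ≤ matrixOpNorm (xorCertificate hk d Φ) := by
      calc τ ^ d ≤ (matrixOpNorm (xorCertificate hk d Φ) ^ (1 / (d : ℝ))) ^ d := by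
            gcongr
            exact (not_le.1 hΦ).le
        _ = _ := by
          rw [one_div]
          exact Real.rpow_inv_natCast_pow hm (by omega)
    calc τ ^ (2 * ℓ * d) = (τ ^ d) ^ (2 * ℓ) := by rw [← pow_mul, mul_comm]
      _ ≤ _ := by gcongr
  have hmarkov := mul_meas_ge_le_integral_of_nonneg (μ := randomXor k n p)
    (f := fun Φ => ((xorCertificate hk d Φ * (xorCertificate hk d Φ).transpose) ^ ℓ).trace)
    (Eventually.of_forall fun Φ => le_trans (pow_nonneg (norm_nonneg _) _)
      (matrixOpNorm_pow_le_trace (xorCertificate hk d Φ) j)) Integrable.of_finite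
    (τ ^ (2 * ℓ * d))
  have hτp : 0 < τ ^ (2 * ℓ * d) := by positivity
  refine le_of_mul_le_mul_left ?_ hτp
  calc _ ≤ _ := mul_le_mul_of_nonneg_left (measureReal_mono hsub) hτp.le
    _ ≤ _ := hmarkov
    _ ≤ _ := htr
    _ ≤ (n : ℝ) ^ (d * r) * (Real.exp (-r) * τ) ^ (2 * ℓ * d) := by gcongr
    _ = τ ^ (2 * ℓ * d) * ((n : ℝ) ^ (d * r) * Real.exp (-r) ^ (2 * ℓ * d)) := by
      rw [mul_pow]; ring
    _ ≤ _ := by gcongr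

theorem mainTheorem7 (k : ℕ) (hk : Even k) (hk2 : 2 ≤ k) :
    ∃ c : ℝ, 0 < c ∧
      ∀ (d : ℕ → ℕ) (p : ℕ → ℝ),
        (∀ᶠ n in atTop, 1 ≤ d n) →
        (∀ᶠ n in atTop, p n ∈ Set.Icc (0 : ℝ) 1) →
        ((fun n : ℕ => (d n : ℝ) * Real.log n) =o[atTop] (fun n : ℕ => (n : ℝ))) →
        (∀ᶠ n : ℕ in atTop, 1 < p n * (d n : ℝ) ^ (k / 2 - 1) * (n : ℝ) ^ (k / 2)) →
        Tendsto
          (fun n : ℕ => randomXor k n (p n)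
            {Φ | matrixOpNorm (xorCertificate hk (d n) Φ) ^ (1 / (d n : ℝ)) ≤
              c * Real.log n ^ (2 * k) *
                (p n ^ (1 / 2 : ℝ) * (n : ℝ) ^ ((k : ℝ) / 4) /
                  (d n : ℝ) ^ (((k : ℝ) - 2) / 4))})
          atTop (𝓝 1) := by
  refine ⟨8 * (10 * Real.exp 2) ^ (k / 2), by positivity, fun d p hd hp _ hpd => ?_⟩
  have hlog : ∀ᶠ n : ℕ in atTop, 1 ≤ Real.log n :=
    (Real.tendsto_log_atTop.comp tendsto_natCast_atTop_atTop).eventually_ge_atTop 1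
  have hlim : Tendsto (fun n : ℕ => ENNReal.ofReal (1 - (n : ℝ)⁻¹)) atTop (𝓝 1) := by
    have h := (tendsto_inv_atTop_nhds_zero_nat (𝕜 := ℝ)).const_sub 1
    simpa using ENNReal.tendsto_ofReal h
  refine tendsto_of_tendsto_of_tendsto_of_le_of_le' hlim tendsto_const_nhds ?_ ?_
  · filter_upwards [hd, hp, hpd, hlog, eventually_ge_atTop 1] with n hdn hpn hpdn hlogn hn
    have := isProbabilityMeasure_randomXor k n hpn
    have h := measure_xorCertificate_norm_gt_le hk hk2 hdn hn hlogn hpn hpdn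
    rw [← Set.compl_ofPred, probReal_compl_eq_one_sub (MeasurableSet.of_discrete)] at h
    refine (ENNReal.ofReal_le_iff_le_toReal (measure_ne_top _ _)).2 ?_
    change _ ≤ (randomXor k n (p n)).real _
    linarith
  · filter_upwards [hp] with n hpn
    have := isProbabilityMeasure_randomXor k n hpn
    exact prob_le_one
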